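/- **Formulae and sequents.** Formulae are built from countably many variables and the constants $0,1$ by the binary connectives $\backslash,\ /,\ \cdot,\ \oplus,\ \&$ and the unary connectives ${}^*$ and $!$. A *sequent* $\Pi\Rightarrow C$ consists of a finite (possibly empty) sequence $\Pi$ of formulae and a formula $C$. We write $A^n$ for $A,\dots,A$ ($n$ times), and $!\Pi$ for $!A_1,\dots,!A_k$ if $\Pi=A_1,\dots,A_k$. **The calculus ${!}\mathbf{ACT}_\omega^{\mathrm m}$.** An *inequation formula* is a formula $(b_1\cdots b_n)\backslash(c_1\cdots c_m)$ with $n,m\ge 0$, where $b_i,c_j$ are variables, products are bracketed in any way, and the empty product is $1$. A *fragment formula* is a formula in which every subformula $!A$ has an inequation formula $A$. The sequents of ${!}\mathbf{ACT}_\omega^{\mathrm m}$ are those consisting of fragment formulae. Its rules, written (premises) / conclusion, are * for $\mathbf{ACT}_\omega$: the axioms $A\Rightarrow A$, $\ \Rightarrow 1$, $\ \Gamma,0,\Delta\Rightarrow C$; $(\Pi\Rightarrow A;\ \Gamma,B,\Delta\Rightarrow C)\,/\,\Gamma,\Pi,A\backslash B,\Delta\Rightarrow C$; $\ (A,\Pi\Rightarrow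 B)\,/\,\Pi\Rightarrow A\backslash B$; $(\Pi\Rightarrow A;\ \Gamma,B,\Delta\Rightarrow C)\,/\,\Gamma,B/A,\Pi,\Delta\Rightarrow C$; $\ (\Pi,A\Rightarrow B)\,/\,\Pi\Rightarrow B/A$; $(\Gamma,A,B,\Delta\Rightarrow C)\,/\,\Gamma,A\cdot B,\Delta\Rightarrow C$; $\ (\Gamma\Rightarrow A;\ \Delta\Rightarrow B)\,/\,\Gamma,\Delta\Rightarrow A\cdot B$; $\ (\Gamma,\Delta\Rightarrow C)\,/\,\Gamma,1,\Delta\Rightarrow C$; $(\Gamma,A_1,\Delta\Rightarrow C;\ \Gamma,A_2,\Delta\Rightarrow C)\,/\,\Gamma,A_1\oplus A_2,\Delta\Rightarrow C$; $\ (\Pi\Rightarrow A_i)\,/\,\Pi\Rightarrow A_1\oplus A_2$; $(\Gamma,A_i,\Delta\Rightarrow C)\,/\,\Gamma,A_1\mathbin{\&}A_2,\Delta\Rightarrow C$; $\ (\Pi\Rightarrow A_1;\ \Pi\Rightarrow A_2)\,/\,\Pi\Rightarrow A_1\mathbin{\&}A_2$ (with $i=1,2$); $(\Gamma,A^n,\Delta\Rightarrow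 C)_{n\in\omega}\,/\,\Gamma,A^*,\Delta\Rightarrow C$; $\ (\Pi_1\Rightarrow A;\dots;\Pi_n\Rightarrow A)\,/\,\Pi_1,\dots,\Pi_n\Rightarrow A^*$ ($n\ge0$); * for $!$: $(\Gamma,A,\Delta\Rightarrow C)\,/\,\Gamma,!A,\Delta\Rightarrow C$; $\ (!\Pi\Rightarrow B)\,/\,!\Pi\Rightarrow\, !B$; $\ (\Gamma,\Pi,!A,\Delta\Rightarrow C)\,/\,\Gamma,!A,\Pi,\Delta\Rightarrow C$ and its converse; $\ (\Gamma,\Delta\Rightarrow C)\,/\,\Gamma,!A,\Delta\Rightarrow C$; $\ (\Gamma,!A,!A,\Delta\Rightarrow C)\,/\,\Gamma,!A,\Delta\Rightarrow C$; * Cut: $(\Pi\Rightarrow A;\ \Gamma,A,\Delta\Rightarrow C)\,/\,\Gamma,\Pi,\Delta\Rightarrow C$. **The dyadic calculus ${!}_{\mathrm d}\mathbf{ACT}_\omega^{\mathrm m}$.** A *d-sequent* $!\Xi;\Gamma\Rightarrow C$ consists of a finite set $!\Xi$ (the *$!$-zone*) of formulae $!A$ with $A$ an inequation formula, a finite sequence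 $\Gamma$ of fragment formulae, and a fragment formula $C$. The rules are: all axioms and rules of $\mathbf{ACT}_\omega$ listed above, with the same $!\Xi;$ prefixed to the antecedent of each sequent; the rules * $(!\Xi\cup\{!A\};\Gamma,\Delta\Rightarrow C)\,/\,!\Xi;\Gamma,!A,\Delta\Rightarrow C$; * $(!\Xi;\ \Rightarrow B)\,/\,!\Xi;\ \Rightarrow\, !B$; * focused absorption: $(!\Xi;\Gamma,c_1,\dots,c_m,\Delta\Rightarrow C)\,/\,\{!((b_1\cdots b_n)\backslash(c_1\cdots c_m))\}\cup{!\Xi};\Gamma,b_1,\dots,b_n,\Delta\Rightarrow C$; and the two cut rules * $(!\Xi;\Pi\Rightarrow A;\ \ !\Xi;\Gamma,A,\Delta\Rightarrow C)\,/\,!\Xi;\Gamma,\Pi,\Delta\Rightarrow C$; * $(!\Xi;\ \Rightarrow B;\ \ !\Xi\cup\{!B\};\Gamma\Rightarrow C)\,/\,!\Xi;\Gamma\Rightarrow C$. In both calculi a derivation is a well-founded (possibly infinite) tree of sequents (respectively d-sequents) of that calculus in which every node is obtained from its children by a rule; axioms are rules without premises. **Proposition.** 1. Every d-sequent derivable in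 ${!}_{\mathrm d}\mathbf{ACT}_\omega^{\mathrm m}$ is derivable in it without using the two cut rules. 2. For every sequent $\Pi\Rightarrow C$: $\Pi\Rightarrow C$ is derivable in ${!}\mathbf{ACT}_\omega^{\mathrm m}$ if and only if the d-sequent $;\Pi\Rightarrow C$ with empty $!$-zone is derivable in ${!}_{\mathrm d}\mathbf{ACT}_\omega^{\mathrm m}$. This holds both when Cut is included among the rules of ${!}\mathbf{ACT}_\omega^{\mathrm m}$ and when it is omitted. -/

import Mathlib

namespace DyadicACT

/-- Formulae of infinitary action logic with exponentiation. The variables are indexed by `ℕ`.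
`ldiv A B` is `A \ B`, `rdiv B A` is `B / A`, `plus` is `⊕`, `wth` is `&`, `kstar A` is `A*`, and
`bang A` is `!A`. -/
inductive Formula : Type
  | var (p : ℕ)
  | zero
  | one
  | ldiv (A B : Formula)
  | rdiv (B A : Formula)
  | mul (A B : Formula)
  | plus (A B : Formula)
  | wth (A B : Formula)
  | kstar (A : Formula)
  | bang (A : Formula)
  deriving DecidableEq

open Formula

/-- `IsProd b B`: the formula `B` is a product `b₁ · … · bₙ` of the variables in the list `b`, with
some arrangement of the brackets. The empty product is the constant `1`. -/
inductive IsProd : List ℕ → Formula → Prop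
  | nil : IsProd [] one
  | single (p : ℕ) : IsProd [p] (var p)
  | mul (b c : List ℕ) (B C : Formula) : b ≠ [] → c ≠ [] → IsProd b B → IsProd c C →
      IsProd (b ++ c) (mul B C)

/-- `A` has the form `(b₁ · … · bₙ) \ (c₁ · … · cₘ)`, with variables `bᵢ`, `cⱼ` and `n, m ≥ 0`. -/
def IsInequation (A : Formula) : Prop :=
  ∃ (b c : List ℕ) (B C : Formula), IsProd b B ∧ IsProd c C ∧ A = ldiv B C

/-- Formulae in the language of the monoidal fragment: every subformula of the form `!A` is
`!((b₁ · … · bₙ) \ (c₁ · … · cₘ))`. -/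
def Formula.IsMonoidal : Formula → Prop
  | var _ => True
  | zero => True
  | one => True
  | ldiv A B => A.IsMonoidal ∧ B.IsMonoidal
  | rdiv B A => B.IsMonoidal ∧ A.IsMonoidal
  | mul A B => A.IsMonoidal ∧ B.IsMonoidal
  | plus A B => A.IsMonoidal ∧ B.IsMonoidal
  | wth A B => A.IsMonoidal ∧ B.IsMonoidal
  | kstar A => A.IsMonoidal
  | bang A => IsInequation A

/-- Sequents `Θ ⇒ C`. -/
@[ext]
structure Sequent : Type where
  ante : List Formula
  succ : Formula

/-- D-sequents `!Ξ; Γ ⇒ C`. The elements of `zone` are the `!`-formulae in `!Ξ`, with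
the `!`; that they are `!`-formulae of the right form is required in `monoidalD` below. -/
@[ext]
structure DSequent : Type where
  zone : Finset Formula
  ante : List Formula
  succ : Formula

/-- Sequents in the language of the monoidal fragment. -/
def monoidal : Set Sequent :=
  {s | (∀ A ∈ s.ante, A.IsMonoidal) ∧ s.succ.IsMonoidal}

/-- D-sequents in the language of the monoidal fragment. -/
def monoidalD : Set DSequent :=
  {s | (∀ A ∈ s.zone, ∃ B, IsInequation B ∧ A = bang B) ∧
    (∀ A ∈ s.ante, A.IsMonoidal) ∧ s.succ.IsMonoidal}

/-- Derivability by well-founded, possibly infinitely branching derivations, all of whose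
sequents belong to `L`. `R P s` says that there is an instance of an inference rule with the
set of premises `P` and the conclusion `s`; rules without premises are axioms. -/
inductive Derivable {S : Type} (L : Set S) (R : Set S → S → Prop) : S → Prop
  | step (P : Set S) (s : S) : s ∈ L → R P s → (∀ p ∈ P, Derivable L R p) → Derivable L R s

/-- The axioms and rules of infinitary action logic, without Cut. -/
inductive ActRule : Set Sequent → Sequent → Prop
  | id (A : Formula) : ActRule ∅ ⟨[A], A⟩
  | ldivL (Γ Θ Δ : List Formula) (A B C : Formula) :
      ActRule {⟨Θ, A⟩, ⟨Γ ++ [B] ++ Δ, C⟩} ⟨Γ ++ Θ ++ [ldiv A B] ++ Δ, C⟩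
  | ldivR (Θ : List Formula) (A B : Formula) :
      ActRule {⟨[A] ++ Θ, B⟩} ⟨Θ, ldiv A B⟩
  | rdivL (Γ Θ Δ : List Formula) (A B C : Formula) :
      ActRule {⟨Θ, A⟩, ⟨Γ ++ [B] ++ Δ, C⟩} ⟨Γ ++ [rdiv B A] ++ Θ ++ Δ, C⟩
  | rdivR (Θ : List Formula) (A B : Formula) :
      ActRule {⟨Θ ++ [A], B⟩} ⟨Θ, rdiv B A⟩
  | mulL (Γ Δ : List Formula) (A B C : Formula) :
      ActRule {⟨Γ ++ [A, B] ++ Δ, C⟩} ⟨Γ ++ [mul A B] ++ Δ, C⟩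
  | mulR (Γ Δ : List Formula) (A B : Formula) :
      ActRule {⟨Γ, A⟩, ⟨Δ, B⟩} ⟨Γ ++ Δ, mul A B⟩
  | oneL (Γ Δ : List Formula) (C : Formula) :
      ActRule {⟨Γ ++ Δ, C⟩} ⟨Γ ++ [one] ++ Δ, C⟩
  | oneR : ActRule ∅ ⟨[], one⟩
  | zeroL (Γ Δ : List Formula) (C : Formula) :
      ActRule ∅ ⟨Γ ++ [zero] ++ Δ, C⟩
  | plusL (Γ Δ : List Formula) (A₁ A₂ C : Formula) :
      ActRule {⟨Γ ++ [A₁] ++ Δ, C⟩, ⟨Γ ++ [A₂] ++ Δ, C⟩} ⟨Γ ++ [plus A₁ A₂] ++ Δ, C⟩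
  | plusR₁ (Θ : List Formula) (A₁ A₂ : Formula) :
      ActRule {⟨Θ, A₁⟩} ⟨Θ, plus A₁ A₂⟩
  | plusR₂ (Θ : List Formula) (A₁ A₂ : Formula) :
      ActRule {⟨Θ, A₂⟩} ⟨Θ, plus A₁ A₂⟩
  | wthL₁ (Γ Δ : List Formula) (A₁ A₂ C : Formula) :
      ActRule {⟨Γ ++ [A₁] ++ Δ, C⟩} ⟨Γ ++ [wth A₁ A₂] ++ Δ, C⟩
  | wthL₂ (Γ Δ : List Formula) (A₁ A₂ C : Formula) :
      ActRule {⟨Γ ++ [A₂] ++ Δ, C⟩} ⟨Γ ++ [wth A₁ A₂] ++ Δ, C⟩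
  | wthR (Θ : List Formula) (A₁ A₂ : Formula) :
      ActRule {⟨Θ, A₁⟩, ⟨Θ, A₂⟩} ⟨Θ, wth A₁ A₂⟩
  | starL (Γ Δ : List Formula) (A C : Formula) :
      ActRule (Set.range fun n : ℕ => ⟨Γ ++ List.replicate n A ++ Δ, C⟩)
        ⟨Γ ++ [kstar A] ++ Δ, C⟩
  | starR (Θs : List (List Formula)) (A : Formula) :
      ActRule {s | ∃ Θ ∈ Θs, s = ⟨Θ, A⟩} ⟨Θs.flatten, kstar A⟩

/-- The rule (Cut). -/
inductive CutRule : Set Sequent → Sequent → Prop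
  | cut (Γ Θ Δ : List Formula) (A C : Formula) :
      CutRule {⟨Θ, A⟩, ⟨Γ ++ [A] ++ Δ, C⟩} ⟨Γ ++ Θ ++ Δ, C⟩

/-- The rules for the exponential modality. -/
inductive BangRule : Set Sequent → Sequent → Prop
  | bangL (Γ Δ : List Formula) (A C : Formula) :
      BangRule {⟨Γ ++ [A] ++ Δ, C⟩} ⟨Γ ++ [bang A] ++ Δ, C⟩
  | bangR (Θ : List Formula) (B : Formula) :
      BangRule {⟨Θ.map bang, B⟩} ⟨Θ.map bang, bang B⟩
  | perm₁ (Γ Θ Δ : List Formula) (A C : Formula) :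
      BangRule {⟨Γ ++ Θ ++ [bang A] ++ Δ, C⟩} ⟨Γ ++ [bang A] ++ Θ ++ Δ, C⟩
  | perm₂ (Γ Θ Δ : List Formula) (A C : Formula) :
      BangRule {⟨Γ ++ [bang A] ++ Θ ++ Δ, C⟩} ⟨Γ ++ Θ ++ [bang A] ++ Δ, C⟩
  | weak (Γ Δ : List Formula) (A C : Formula) :
      BangRule {⟨Γ ++ Δ, C⟩} ⟨Γ ++ [bang A] ++ Δ, C⟩
  | contr (Γ Δ : List Formula) (A C : Formula) :
      BangRule {⟨Γ ++ [bang A, bang A] ++ Δ, C⟩} ⟨Γ ++ [bang A] ++ Δ, C⟩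

/-- The rules of infinitary action logic with exponentiation, without Cut. -/
def EactCutFreeRule (P : Set Sequent) (s : Sequent) : Prop :=
  ActRule P s ∨ BangRule P s

/-- The rules of infinitary action logic with exponentiation, with Cut. -/
def EactRule (P : Set Sequent) (s : Sequent) : Prop :=
  EactCutFreeRule P s ∨ CutRule P s

/-- Adding the `!`-zone `Ξ` to a sequent. -/
def Sequent.addZone (Ξ : Finset Formula) (s : Sequent) : DSequent :=
  ⟨Ξ, s.ante, s.succ⟩

/-- The rules of the dyadic calculus, without cut rules. The rules that do not operate with `!`
come from `ActRule` by adding one and the same `!`-zone to all sequents. -/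
inductive DyadicCutFreeRule : Set DSequent → DSequent → Prop
  | act (Ξ : Finset Formula) (P : Set Sequent) (s : Sequent) : ActRule P s →
      DyadicCutFreeRule (Sequent.addZone Ξ '' P) (s.addZone Ξ)
  | bangL (Ξ : Finset Formula) (Γ Δ : List Formula) (A C : Formula) :
      DyadicCutFreeRule {⟨Ξ ∪ {bang A}, Γ ++ Δ, C⟩} ⟨Ξ, Γ ++ [bang A] ++ Δ, C⟩
  | bangR (Ξ : Finset Formula) (B : Formula) :
      DyadicCutFreeRule {⟨Ξ, [], B⟩} ⟨Ξ, [], bang B⟩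
  | absorb (Ξ : Finset Formula) (Γ Δ : List Formula) (b c : List ℕ) (B C D : Formula) :
      IsProd b B → IsProd c C →
      DyadicCutFreeRule {⟨Ξ, Γ ++ c.map var ++ Δ, D⟩}
        ⟨{bang (ldiv B C)} ∪ Ξ, Γ ++ b.map var ++ Δ, D⟩

/-- The two cut rules of the dyadic calculus. -/
inductive DyadicCutRule : Set DSequent → DSequent → Prop
  | cut₁ (Ξ : Finset Formula) (Γ Θ Δ : List Formula) (A C : Formula) :
      DyadicCutRule {⟨Ξ, Θ, A⟩, ⟨Ξ, Γ ++ [A] ++ Δ, C⟩} ⟨Ξ, Γ ++ Θ ++ Δ, C⟩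
  | cut₂ (Ξ : Finset Formula) (Γ : List Formula) (B C : Formula) :
      DyadicCutRule {⟨Ξ, [], B⟩, ⟨Ξ ∪ {bang B}, Γ, C⟩} ⟨Ξ, Γ, C⟩

/-- The rules of the dyadic calculus, with the cut rules. -/
def DyadicRule (P : Set DSequent) (s : DSequent) : Prop :=
  DyadicCutFreeRule P s ∨ DyadicCutRule P s

/-- Derivability in the monoidal fragment of infinitary action logic with exponentiation,
with Cut. -/
def EactmDerivable (s : Sequent) : Prop := Derivable monoidal EactRule s

/-- Derivability without Cut in the monoidal fragment of infinitary action logic with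
exponentiation. -/
def EactmCutFreeDerivable (s : Sequent) : Prop := Derivable monoidal EactCutFreeRule s

/-- Derivability in the dyadic calculus, with the cut rules. -/
def DyadicDerivable (s : DSequent) : Prop := Derivable monoidalD DyadicRule s

/-- Derivability in the dyadic calculus without the cut rules. -/
def DyadicCutFreeDerivable (s : DSequent) : Prop := Derivable monoidalD DyadicCutFreeRule s

end DyadicACT

namespace DyadicACT

open Formula
open scoped Pointwise

/-! ### Well-founded derivations over an arbitrary language and rule set -/

section General

variable {S : Type} {L L' : Set S} {R R' : Set S → S → Prop}

/-! Cut elimination is semantic, by a phase space built from cut-free provability. Its elements are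
antecedents (a zone and a word), multiplied by union and concatenation. A fact is a set closed under
`cl`, the closure given by cut-free provability in all contexts. Formulae are interpreted as facts,
with `!A` generated by the zone-only elements of `interp A`. Such elements are central and
idempotent, and facts are closed under multiplication by them; this gives exchange, contraction and
weakening.

Both calculi are sound for this model with their cut rules (`Derivable.validAt_one`,
`Derivable.valid`). Conversely, `interp_adequate` shows that the word `A` lies in `interp A` and
that every element of `interp A` proves `A` without cut. Hence valid d-sequents of the fragment are
cut-free derivable, which gives part 1 and one direction of part 2. The fragment matters in one
place: the zone `{!A}` must lie in `interp A`. For an inequation this is focused absorption, because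
variables denote facts generated by one word.

For the other direction, a cut-free dyadic derivation is translated rule by rule, with the zone
written as `!`-formulae in front of the antecedent (`Derivable.eactProves`). Derivations are built
in the full language and restricted to the fragment afterwards by the subformula property. -/

theorem Derivable.mem {s : S} (h : Derivable L R s) : s ∈ L := by
  cases h with
  | step _ _ hs _ _ => exact hs

theorem Derivable.mono (hL : L ⊆ L') (hR : ∀ P s, R P s → R' P s) {s : S}
    (h : Derivable L R s) : Derivable L' R' s := by
  induction h with
  | step P s hs hr _ ih => exact .step P s (hL hs) (hR P s hr) ih

/-- A language closed under taking premises of rules contains all derivations of its sequents. -/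
theorem Derivable.restrict (hR : ∀ P s, R P s → s ∈ L → ∀ p ∈ P, p ∈ L) {s : S}
    (h : Derivable Set.univ R s) (hs : s ∈ L) : Derivable L R s := by
  induction h with
  | step P s _ hr _ ih => exact .step P s hs hr fun p hp => ih p hp (hR P s hr hs p hp)

end General

/-! ### Subformula property of the cut-free rules -/

section Subformula

theorem IsProd.isMonoidal {b : List ℕ} {B : Formula} (h : IsProd b B) : B.IsMonoidal := by
  induction h with
  | nil => trivial
  | single p => trivial
  | mul b c B C _ _ _ _ hB hC => exact ⟨hB, hC⟩

theorem IsInequation.isMonoidal {A : Formula} (h : IsInequation A) : A.IsMonoidal := by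
  obtain ⟨b, c, B, C, hB, hC, rfl⟩ := h
  exact ⟨hB.isMonoidal, hC.isMonoidal⟩

theorem ActRule.premise_monoidal {P : Set Sequent} {s : Sequent} (h : ActRule P s)
    (hs : s ∈ monoidal) : ∀ p ∈ P, p ∈ monoidal := by
  cases h <;>
    simp only [monoidal, Set.mem_ofPred_eq, Set.mem_insert_iff, Set.mem_singleton_iff,
      Set.mem_empty_iff_false, Set.mem_range, List.mem_append, or_imp,
      forall_and, List.mem_cons, List.not_mem_nil, forall_eq, Formula.IsMonoidal, false_imp_iff,
      implies_true, and_true, List.mem_flatten, forall_exists_index,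
      and_imp] at hs ⊢
  case starL => grind
  case starR =>
    refine ⟨?_, ?_⟩
    · rintro _ Θ hΘ rfl A hA
      exact hs.1 A Θ hΘ hA
    · rintro _ Θ hΘ rfl
      exact hs.2
  all_goals tauto

theorem BangRule.premise_monoidal {P : Set Sequent} {s : Sequent} (h : BangRule P s)
    (hs : s ∈ monoidal) : ∀ p ∈ P, p ∈ monoidal := by
  cases h <;>
    simp only [monoidal, Set.mem_ofPred_eq, Set.mem_singleton_iff, List.mem_append, or_imp,
      forall_and, List.mem_cons, List.not_mem_nil, forall_eq, Formula.IsMonoidal, false_imp_iff,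
      and_true] at hs ⊢
  case bangL => exact ⟨⟨⟨hs.1.1.1, hs.1.1.2.isMonoidal⟩, hs.1.2⟩, hs.2⟩
  case bangR => exact ⟨hs.1, hs.2.isMonoidal⟩
  all_goals tauto

theorem EactCutFreeRule.premise_monoidal (P : Set Sequent) (s : Sequent)
    (h : EactCutFreeRule P s) (hs : s ∈ monoidal) : ∀ p ∈ P, p ∈ monoidal :=
  h.elim (·.premise_monoidal hs) (·.premise_monoidal hs)

/-- The fragment condition on `!A` in the antecedent is exactly what the zone demands when `bangL`
moves it there; absorption introduces only variables. -/
theorem DyadicCutFreeRule.premise_monoidalD (P : Set DSequent) (s : DSequent)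
    (h : DyadicCutFreeRule P s) (hs : s ∈ monoidalD) : ∀ p ∈ P, p ∈ monoidalD := by
  cases h with
  | act Ξ P s h =>
    rintro _ ⟨p, hp, rfl⟩
    exact ⟨hs.1, h.premise_monoidal hs.2 p hp⟩
  | bangL Ξ Γ Δ A C =>
    rintro _ rfl
    obtain ⟨h1, h2, h3⟩ := hs
    refine ⟨fun F hF => ?_, fun F hF => h2 F (by simp at hF ⊢; tauto), h3⟩
    rcases Finset.mem_union.1 hF with hF | hF
    · exact h1 F hF
    · exact ⟨A, h2 (bang A) (by simp), Finset.mem_singleton.1 hF⟩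
  | bangR Ξ B =>
    rintro _ rfl
    exact ⟨hs.1, hs.2.1, IsInequation.isMonoidal hs.2.2⟩
  | absorb Ξ Γ Δ b c B C D hB hC =>
    rintro _ rfl
    obtain ⟨h1, h2, h3⟩ := hs
    refine ⟨fun F hF => h1 F (Finset.mem_union_right _ hF), fun F hF => ?_, h3⟩
    simp only [List.mem_append, List.mem_map] at hF h2
    rcases hF with (hF | ⟨p, _, rfl⟩) | hF
    · exact h2 F (.inl (.inl hF))
    · trivial
    · exact h2 F (.inr hF)

end Subformula

/-! ### The phase space of antecedents and its closure operator -/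

section PhaseSpace

/-- Elements of the phase space: antecedents of d-sequents. -/
@[ext]
structure Phase : Type where
  zone : Finset Formula
  ante : List Formula

namespace Phase

instance : Monoid Phase where
  mul x y := ⟨x.zone ∪ y.zone, x.ante ++ y.ante⟩
  one := ⟨∅, []⟩
  mul_assoc x y z := Phase.ext (Finset.union_assoc _ _ _) (List.append_assoc _ _ _)
  one_mul x := Phase.ext (Finset.empty_union _) (List.nil_append _)
  mul_one x := Phase.ext (Finset.union_empty _) (List.append_nil _)

@[simp] theorem zone_mul (x y : Phase) : (x * y).zone = x.zone ∪ y.zone := rfl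

@[simp] theorem ante_mul (x y : Phase) : (x * y).ante = x.ante ++ y.ante := rfl

@[simp] theorem ante_one : (1 : Phase).ante = [] := rfl

/-- Zones are sets, so zone-only elements are central and, by the next lemma, idempotent: the
semantic form of exchange and contraction for `!`. -/
theorem comm_of_ante_eq_nil {z : Phase} (hz : z.ante = []) (x : Phase) : z * x = x * z :=
  Phase.ext (Finset.union_comm _ _) (by simp [hz])

theorem mul_self_of_ante_eq_nil {z : Phase} (hz : z.ante = []) : z * z = z :=
  Phase.ext (Finset.union_self _) (by simp [hz])

theorem mul_left_of_ante_eq_nil {z : Phase} (hz : z.ante = []) (x y : Phase) :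
    x * (z * y) = z * (x * y) := by
  rw [← mul_assoc, ← comm_of_ante_eq_nil hz, mul_assoc]

/-- Cut-free derivability in the dyadic calculus, without restriction of the language. -/
def Proves (x : Phase) (C : Formula) : Prop :=
  Derivable Set.univ DyadicCutFreeRule ⟨x.zone, x.ante, C⟩

theorem Proves.of_rule {P : Set DSequent} {x : Phase} {C : Formula}
    (h : DyadicCutFreeRule P ⟨x.zone, x.ante, C⟩)
    (hP : ∀ p ∈ P, Proves ⟨p.zone, p.ante⟩ p.succ) : Proves x C :=
  .step P _ trivial h hP

theorem Proves.of_actRule {P : Set Sequent} {x : Phase} {Γ : List Formula} {C : Formula}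
    (h : ActRule P ⟨Γ, C⟩) (hx : x.ante = Γ)
    (hP : ∀ p ∈ P, Proves ⟨x.zone, p.ante⟩ p.succ) : Proves x C := by
  subst hx
  refine Proves.of_rule (.act x.zone P _ h) ?_
  rintro _ ⟨p, hp, rfl⟩
  exact hP p hp

/-- Every rule stays an instance of itself when all its zones are enlarged by the same set. This
weakening also lets premises with different zones be brought to a common one. -/
theorem derivable_zone_union {s : DSequent} (h : Derivable Set.univ DyadicCutFreeRule s)
    (Ξ' : Finset Formula) :
    Derivable Set.univ DyadicCutFreeRule ⟨s.zone ∪ Ξ', s.ante, s.succ⟩ := by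
  induction h with
  | step P s _ hr _ ih =>
    cases hr with
    | act Ξ P s h =>
      refine .step _ _ trivial (.act (Ξ ∪ Ξ') P s h) ?_
      rintro _ ⟨p, hp, rfl⟩
      exact ih _ ⟨p, hp, rfl⟩
    | bangL Ξ Γ Δ A C =>
      refine .step _ _ trivial (.bangL (Ξ ∪ Ξ') Γ Δ A C) ?_
      rintro _ rfl
      simpa only [Finset.union_right_comm] using ih _ rfl
    | bangR Ξ B =>
      refine .step _ _ trivial (.bangR (Ξ ∪ Ξ') B) ?_
      rintro _ rfl
      exact ih _ rfl
    | absorb Ξ Γ Δ b c B C D hB hC =>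
      simp only [Finset.union_assoc]
      refine .step _ _ trivial (.absorb (Ξ ∪ Ξ') Γ Δ b c B C D hB hC) ?_
      rintro _ rfl
      exact ih _ rfl

theorem Proves.mono {x y : Phase} {C : Formula} (h : Proves x C) (hz : x.zone ⊆ y.zone)
    (ha : y.ante = x.ante) : Proves y C := by
  have := derivable_zone_union h y.zone
  rw [Proves, ha]
  rwa [Finset.union_eq_right.2 hz] at this

/-- The closure operator of the phase space. -/
def cl (X : Set Phase) : Set Phase :=
  {y | ∀ (a b : Phase) (C : Formula), (∀ x ∈ X, Proves (a * x * b) C) → Proves (a * y * b) C}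

theorem subset_cl (X : Set Phase) : X ⊆ cl X := fun x hx _ _ _ h => h x hx

/-- Facts of the phase space: sets closed under `cl`. -/
def IsFact (Y : Set Phase) : Prop := cl Y ⊆ Y

/-- Membership in a fact can be checked on generators, in any context. -/
theorem IsFact.mul_mul_mem {X Y : Set Phase} (hY : IsFact Y) {a b : Phase}
    (h : ∀ x ∈ X, a * x * b ∈ Y) {x : Phase} (hx : x ∈ cl X) : a * x * b ∈ Y := by
  refine hY fun c d C hC => ?_
  have := hx (c * a) (b * d) C fun x hx => by simpa only [mul_assoc] using hC _ (h x hx)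
  simpa only [mul_assoc] using this

theorem IsFact.cl_subset {X Y : Set Phase} (hY : IsFact Y) (h : X ⊆ Y) : cl X ⊆ Y := by
  intro x hx
  simpa using hY.mul_mul_mem (a := 1) (b := 1) (fun x hx => by simpa using h hx) hx

theorem isFact_cl (X : Set Phase) : IsFact (cl X) :=
  fun _ hy a b C h => hy a b C fun _ hx => hx a b C h

theorem cl_mono {X Y : Set Phase} (h : X ⊆ Y) : cl X ⊆ cl Y :=
  (isFact_cl Y).cl_subset (h.trans (subset_cl Y))

/-- Each factor is reduced to generators in turn, the other one serving as context. -/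
theorem IsFact.mul_mem {X X' Y : Set Phase} (hY : IsFact Y) (h : X * X' ⊆ Y) :
    cl X * cl X' ⊆ Y := by
  rintro _ ⟨x, hx, x', hx', rfl⟩
  have := hY.mul_mul_mem (a := 1) (b := x') (X := X) (fun x hx => ?_) hx
  · simpa using this
  have := hY.mul_mul_mem (a := x) (b := 1) (X := X') (fun x' hx' => ?_) hx'
  · simpa using this
  simpa using h (Set.mul_mem_mul hx hx')

/-- Semantic weakening: by zone weakening, any context that proves `x` also proves `z * x`. -/
theorem IsFact.zone_mul_mem {Y : Set Phase} (hY : IsFact Y) {z x : Phase} (hz : z.ante = [])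
    (hx : x ∈ Y) : z * x ∈ Y :=
  hY fun _ _ _ h => (h x hx).mono (by simp; grind) (by simp [hz])

theorem isFact_proves (C : Formula) : IsFact {x | Proves x C} := by
  intro y hy
  simpa using hy 1 1 C fun x hx => by simpa using hx

end Phase

end PhaseSpace

/-! ### Interpretation of formulae and soundness of both calculi with cut -/

section Interpretation

open Phase

/-- The interpretation of formulae in the phase space. A variable is interpreted as the least fact
that contains it, so that focused absorption is valid. -/
def interp : Formula → Set Phase
  | var p => cl {⟨∅, [var p]⟩}
  | zero => cl ∅
  | one => cl {1}
  | ldiv A B => {y | ∀ x ∈ interp A, x * y ∈ interp B}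
  | rdiv B A => {y | ∀ x ∈ interp A, y * x ∈ interp B}
  | mul A B => cl (interp A * interp B)
  | plus A B => cl (interp A ∪ interp B)
  | wth A B => interp A ∩ interp B
  | kstar A => cl (⋃ n : ℕ, interp A ^ n)
  | bang A => cl {z | z.ante = [] ∧ z ∈ interp A}

theorem isFact_interp (A : Formula) : IsFact (interp A) := by
  induction A with
  | ldiv A B _ hB =>
    intro y hy x hx
    simpa using hB.mul_mul_mem (a := x) (b := 1) (fun y hy => by simpa using hy x hx) hy
  | rdiv B A hB _ =>
    intro y hy x hx
    simpa using hB.mul_mul_mem (a := 1) (b := x) (fun y hy => by simpa using hy x hx) hy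
  | wth A B hA hB =>
    exact fun y hy => ⟨hA (cl_mono Set.inter_subset_left hy), hB (cl_mono Set.inter_subset_right hy)⟩
  | _ => exact isFact_cl _

/-- The interpretation of sequences of formulae. -/
def interpSeq (Γ : List Formula) : Set Phase := (Γ.map interp).prod

@[simp] theorem interpSeq_nil : interpSeq [] = 1 := rfl

@[simp] theorem interpSeq_append (Γ Δ : List Formula) :
    interpSeq (Γ ++ Δ) = interpSeq Γ * interpSeq Δ := by
  simp [interpSeq]

theorem interpSeq_cons (A : Formula) (Γ : List Formula) :
    interpSeq (A :: Γ) = interp A * interpSeq Γ := by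
  simp [interpSeq]

@[simp] theorem interpSeq_singleton (A : Formula) : interpSeq [A] = interp A := by
  simp [interpSeq]

@[simp] theorem interpSeq_replicate (n : ℕ) (A : Formula) :
    interpSeq (List.replicate n A) = interp A ^ n := by
  simp [interpSeq]

/-- Validity of a sequent relative to an element `z` of the phase space. -/
def ValidAt (z : Phase) (s : Sequent) : Prop := ∀ x ∈ interpSeq s.ante, z * x ∈ interp s.succ

theorem validAt_context {z : Phase} {Γ Φ Δ : List Formula} {C : Formula} :
    ValidAt z ⟨Γ ++ Φ ++ Δ, C⟩ ↔ ∀ g ∈ interpSeq Γ, ∀ d ∈ interpSeq Δ, ∀ f ∈ interpSeq Φ,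
      (z * g) * f * d ∈ interp C := by
  simp only [ValidAt, interpSeq_append, Set.mem_mul]
  constructor
  · intro h g hg d hd f hf
    simpa only [mul_assoc] using h _ ⟨_, ⟨g, hg, f, hf, rfl⟩, d, hd, rfl⟩
  · rintro h _ ⟨_, ⟨g, hg, f, hf, rfl⟩, d, hd, rfl⟩
    simpa only [mul_assoc] using h g hg d hd f hf

/-- The element `z` stands for the shared zone. Being central and idempotent, it can be used once
per premise and the copies merged. Left rules for connectives interpreted by a closure need checking
only on generators. -/
theorem ActRule.sound {z : Phase} (hz : z.ante = []) {P : Set Sequent} {s : Sequent}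
    (h : ActRule P s) (hP : ∀ p ∈ P, ValidAt z p) : ValidAt z s := by
  cases h with
  | id A =>
    intro x hx
    exact (isFact_interp A).zone_mul_mem hz (by simpa using hx)
  | ldivL Γ Θ Δ A B C =>
    have h1 := hP _ (.inl rfl)
    have h2 := validAt_context.1 (hP _ (.inr rfl))
    rw [List.append_assoc Γ, validAt_context]
    rintro g hg d hd f hf
    rw [interpSeq_append, interpSeq_singleton] at hf
    obtain ⟨t, ht, f, hf, rfl⟩ := hf
    have := h2 g hg d hd ((z * t) * f) (by simpa using hf _ (h1 t ht))
    simp only [mul_assoc, mul_left_of_ante_eq_nil hz] at this ⊢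
    simpa only [← mul_assoc, mul_self_of_ante_eq_nil hz] using this
  | ldivR Θ A B =>
    intro x hx y hy
    have := hP _ rfl (y * x) (by simpa [interpSeq_cons] using Set.mul_mem_mul hy hx)
    rwa [mul_left_of_ante_eq_nil hz]
  | rdivL Γ Θ Δ A B C =>
    have h1 := hP _ (.inl rfl)
    have h2 := validAt_context.1 (hP _ (.inr rfl))
    rw [List.append_assoc Γ, validAt_context]
    rintro g hg d hd f hf
    rw [interpSeq_append, interpSeq_singleton] at hf
    obtain ⟨f, hf, t, ht, rfl⟩ := hf
    have := h2 g hg d hd (f * (z * t)) (by simpa using hf _ (h1 t ht))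
    simp only [mul_assoc, mul_left_of_ante_eq_nil hz] at this ⊢
    simpa only [← mul_assoc, mul_self_of_ante_eq_nil hz] using this
  | rdivR Θ A B =>
    intro x hx y hy
    have := hP _ rfl (x * y) (by simpa using Set.mul_mem_mul hx hy)
    rwa [mul_assoc]
  | mulL Γ Δ A B C =>
    have h1 := validAt_context.1 (hP _ rfl)
    rw [validAt_context]
    intro g hg d hd f hf
    refine (isFact_interp C).mul_mul_mem (fun x hx => h1 g hg d hd x ?_)
      (by simpa [interp] using hf)
    simpa [interpSeq_cons] using hx
  | mulR Γ Δ A B =>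
    intro x hx
    rw [interpSeq_append] at hx
    obtain ⟨g, hg, d, hd, rfl⟩ := hx
    have := subset_cl _ (Set.mul_mem_mul (hP _ (.inl rfl) g hg) (hP _ (.inr rfl) d hd))
    simp only [mul_assoc, mul_left_of_ante_eq_nil hz] at this
    simpa only [← mul_assoc, mul_self_of_ante_eq_nil hz, interp] using this
  | oneL Γ Δ C =>
    rw [validAt_context]
    intro g hg d hd f hf
    refine (isFact_interp C).mul_mul_mem (X := {1}) ?_ (by simpa [interp] using hf)
    rintro _ rfl
    simpa [mul_assoc] using hP _ rfl (g * d) (by simpa using Set.mul_mem_mul hg hd)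
  | oneR =>
    intro x hx
    obtain rfl : x = 1 := by simpa using hx
    exact (isFact_interp one).zone_mul_mem hz (subset_cl _ rfl)
  | zeroL Γ Δ C =>
    rw [validAt_context]
    intro g hg d hd f hf
    exact (isFact_interp C).mul_mul_mem (X := ∅) (by simp) (by simpa [interp] using hf)
  | plusL Γ Δ A₁ A₂ C =>
    have h1 := validAt_context.1 (hP _ (.inl rfl))
    have h2 := validAt_context.1 (hP _ (.inr rfl))
    rw [validAt_context]
    intro g hg d hd f hf
    refine (isFact_interp C).mul_mul_mem (fun x hx => ?_) (by simpa [interp] using hf)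
    rcases hx with hx | hx
    · exact h1 g hg d hd x (by simpa using hx)
    · exact h2 g hg d hd x (by simpa using hx)
  | plusR₁ Θ A₁ A₂ => exact fun x hx => subset_cl _ (.inl (hP _ rfl x hx))
  | plusR₂ Θ A₁ A₂ => exact fun x hx => subset_cl _ (.inr (hP _ rfl x hx))
  | wthL₁ Γ Δ A₁ A₂ C =>
    have h1 := validAt_context.1 (hP _ rfl)
    rw [validAt_context]
    intro g hg d hd f hf
    rw [interpSeq_singleton] at hf
    exact h1 g hg d hd f (by simpa using hf.1)
  | wthL₂ Γ Δ A₁ A₂ C =>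
    have h1 := validAt_context.1 (hP _ rfl)
    rw [validAt_context]
    intro g hg d hd f hf
    rw [interpSeq_singleton] at hf
    exact h1 g hg d hd f (by simpa using hf.2)
  | wthR Θ A₁ A₂ => exact fun x hx => ⟨hP _ (.inl rfl) x hx, hP _ (.inr rfl) x hx⟩
  | starL Γ Δ A C =>
    rw [validAt_context]
    intro g hg d hd f hf
    refine (isFact_interp C).mul_mul_mem (fun x hx => ?_) (by simpa [interp] using hf)
    obtain ⟨n, hn⟩ := Set.mem_iUnion.1 hx
    exact validAt_context.1 (hP _ ⟨n, rfl⟩) g hg d hd x (by simpa using hn)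
  | starR Θs A =>
    intro x hx
    -- `y` carries one copy of `z` per premise, hence none for an empty list; the factor `z` on both
    -- sides makes the equation uniform.
    suffices h : ∃ y ∈ interp A ^ Θs.length, z * x = z * y by
      obtain ⟨y, hy, h⟩ := h
      change z * x ∈ _
      rw [h]
      exact (isFact_interp (kstar A)).zone_mul_mem hz
        (subset_cl _ (Set.mem_iUnion.2 ⟨_, hy⟩))
    have hP' : ∀ Θ ∈ Θs, ValidAt z ⟨Θ, A⟩ := fun Θ hΘ => hP _ ⟨Θ, hΘ, rfl⟩
    clear hP
    change x ∈ interpSeq Θs.flatten at hx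
    induction Θs generalizing x with
    | nil => exact ⟨x, by simpa using hx, rfl⟩
    | cons Θ Θs ih =>
      rw [List.flatten_cons, interpSeq_append] at hx
      obtain ⟨t, ht, x, hx, rfl⟩ := hx
      obtain ⟨y, hy, h⟩ := ih x (fun Θ' h' => hP' Θ' (List.mem_cons_of_mem _ h')) hx
      refine ⟨(z * t) * y, ?_, ?_⟩
      · rw [List.length_cons, pow_succ']
        exact Set.mul_mem_mul (hP' Θ List.mem_cons_self t ht) hy
      · change z * (t * x) = _
        rw [← mul_assoc, ← mul_assoc, ← mul_assoc, mul_self_of_ante_eq_nil hz,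
          comm_of_ante_eq_nil hz t, mul_assoc, mul_assoc, h]

theorem CutRule.sound {z : Phase} (hz : z.ante = []) {P : Set Sequent} {s : Sequent}
    (h : CutRule P s) (hP : ∀ p ∈ P, ValidAt z p) : ValidAt z s := by
  cases h with
  | cut Γ Θ Δ A C =>
    have h1 := hP _ (.inl rfl)
    have h2 := validAt_context.1 (hP _ (.inr rfl))
    rw [validAt_context]
    intro g hg d hd t ht
    have := h2 g hg d hd (z * t) (by simpa using h1 t ht)
    simp only [mul_assoc, mul_left_of_ante_eq_nil hz] at this ⊢
    simpa only [← mul_assoc, mul_self_of_ante_eq_nil hz] using this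

/-- Validity of a sequence starting with `!A` can be checked on the generators of its
interpretation. -/
theorem mul_mul_mem_of_bang {A C : Formula} {a b f : Phase} (hf : f ∈ interpSeq [bang A])
    (h : ∀ z : Phase, z.ante = [] → z ∈ interp A → a * z * b ∈ interp C) :
    a * f * b ∈ interp C :=
  (isFact_interp C).mul_mul_mem (X := {z | z.ante = [] ∧ z ∈ interp A})
    (fun z hz => h z hz.1 hz.2) (by simpa [interp] using hf)

/-- A product of zone-only elements is zone-only. Thus the rule introducing `!` on the right, whose
antecedent is `!Π`, can be checked on zone-only elements. -/
theorem interpSeq_map_bang_subset (Θ : List Formula) :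
    interpSeq (Θ.map bang) ⊆ cl {z | z.ante = [] ∧ z ∈ interpSeq (Θ.map bang)} := by
  induction Θ with
  | nil => exact fun x hx => subset_cl _ ⟨by simp_all, hx⟩
  | cons A Θ ih =>
    rw [List.map_cons, interpSeq_cons]
    refine (Set.mul_subset_mul le_rfl ih).trans ((isFact_cl _).mul_mem ?_)
    rintro _ ⟨x, hx, y, hy, rfl⟩
    exact subset_cl _ ⟨by simp [hx.1, hy.1], Set.mul_mem_mul (subset_cl _ hx) hy.2⟩

theorem BangRule.sound {P : Set Sequent} {s : Sequent} (h : BangRule P s)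
    (hP : ∀ p ∈ P, ValidAt 1 p) : ValidAt 1 s := by
  cases h with
  | bangL Γ Δ A C =>
    have h1 := validAt_context.1 (hP _ rfl)
    rw [validAt_context]
    intro g hg d hd f hf
    exact mul_mul_mem_of_bang hf fun z _ hz => h1 g hg d hd z (by simpa using hz)
  | bangR Θ B =>
    intro x hx
    rw [one_mul]
    refine (isFact_interp (bang B)).cl_subset ?_ (interpSeq_map_bang_subset Θ hx)
    intro z hz
    exact subset_cl _ ⟨hz.1, by simpa using hP _ rfl z hz.2⟩
  | perm₁ Γ Θ Δ A C =>
    have h1 := hP _ rfl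
    rw [List.append_assoc Γ, validAt_context] at h1 ⊢
    intro g hg d hd f hf
    rw [interpSeq_append] at hf
    obtain ⟨f, hf, t, ht, rfl⟩ := hf
    have := mul_mul_mem_of_bang (a := 1 * g) (b := t * d) (C := C) hf fun z hz hzA => by
      have hzA' : z ∈ interp (bang A) := subset_cl _ ⟨hz, hzA⟩
      have := h1 g hg d hd (t * z) (by simpa using Set.mul_mem_mul ht hzA')
      rw [← comm_of_ante_eq_nil hz t] at this
      simpa only [mul_assoc] using this
    simpa only [mul_assoc] using this
  | perm₂ Γ Θ Δ A C =>
    have h1 := hP _ rfl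
    rw [List.append_assoc Γ, validAt_context] at h1 ⊢
    intro g hg d hd f hf
    rw [interpSeq_append] at hf
    obtain ⟨t, ht, f, hf, rfl⟩ := hf
    have := mul_mul_mem_of_bang (a := 1 * g * t) (b := d) (C := C) hf fun z hz hzA => by
      have hzA' : z ∈ interp (bang A) := subset_cl _ ⟨hz, hzA⟩
      have := h1 g hg d hd (z * t) (by simpa [interpSeq_cons] using Set.mul_mem_mul hzA' ht)
      rw [comm_of_ante_eq_nil hz t] at this
      simpa only [mul_assoc] using this
    simpa only [mul_assoc] using this
  | weak Γ Δ A C =>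
    rw [validAt_context]
    intro g hg d hd f hf
    refine mul_mul_mem_of_bang hf fun z hz _ => ?_
    have := (isFact_interp C).zone_mul_mem hz
      (hP _ rfl (g * d) (by simpa using Set.mul_mem_mul hg hd))
    simpa only [mul_assoc, mul_left_of_ante_eq_nil hz, one_mul] using this
  | contr Γ Δ A C =>
    have h1 := validAt_context.1 (hP _ rfl)
    rw [validAt_context]
    intro g hg d hd f hf
    refine mul_mul_mem_of_bang hf fun z hz hzA => ?_
    have hzA' : z ∈ interp (bang A) := subset_cl _ ⟨hz, hzA⟩
    have := h1 g hg d hd (z * z) (by simpa [interpSeq_cons] using Set.mul_mem_mul hzA' hzA')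
    rwa [mul_self_of_ante_eq_nil hz] at this

theorem Derivable.validAt_one {L : Set Sequent} {s : Sequent} (h : Derivable L EactRule s) :
    ValidAt 1 s := by
  induction h with
  | step P s _ hr _ ih =>
    rcases hr with (hr | hr) | hr
    · exact hr.sound rfl ih
    · exact hr.sound ih
    · exact hr.sound rfl ih

/-- The closure of a product does not change when the factors are closed first, so bracketing is
irrelevant. -/
theorem IsProd.interp_eq {b : List ℕ} {B : Formula} (h : IsProd b B) :
    interp B = cl (interpSeq (b.map var)) := by
  induction h with
  | nil => rfl
  | single p =>
    rw [List.map_singleton, interpSeq_singleton]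
    exact (subset_cl _).antisymm (isFact_interp _)
  | mul b c B C _ _ _ _ hB hC =>
    rw [List.map_append, interpSeq_append, interp]
    refine ((isFact_cl _).cl_subset ?_).antisymm (cl_mono (Set.mul_subset_mul ?_ ?_))
    · rw [hB, hC]
      exact (isFact_cl _).mul_mem (subset_cl _)
    · exact hB ▸ subset_cl _
    · exact hC ▸ subset_cl _

/-- `z` consists of a `!`-zone only and belongs to the interpretations of the formulae `A` with
`!A` in the zone `Ξ`. -/
def Realizes (z : Phase) (Ξ : Finset Formula) : Prop :=
  z.ante = [] ∧ ∀ A, bang A ∈ Ξ → z ∈ interp A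

/-- Validity of d-sequents. -/
def DSequent.Valid (s : DSequent) : Prop :=
  ∀ z : Phase, Realizes z s.zone → ValidAt z ⟨s.ante, s.succ⟩

theorem DyadicCutFreeRule.sound {P : Set DSequent} {s : DSequent} (h : DyadicCutFreeRule P s)
    (hP : ∀ p ∈ P, p.Valid) : s.Valid := by
  intro z hz
  cases h with
  | act Ξ P s h => exact h.sound hz.1 fun p hp => hP _ ⟨p, hp, rfl⟩ z hz
  | bangL Ξ Γ Δ A C =>
    rw [validAt_context]
    intro g hg d hd f hf
    refine mul_mul_mem_of_bang hf fun y hy hyA => ?_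
    -- Adding `!A` to the zone corresponds to multiplying the realizer by a generator of `!A`;
    -- weakening preserves the old memberships.
    have hzy : Realizes (z * y) (Ξ ∪ {bang A}) := by
      refine ⟨by simp [hz.1, hy], fun B hB => ?_⟩
      rcases Finset.mem_union.1 hB with hB | hB
      · rw [comm_of_ante_eq_nil hz.1]
        exact (isFact_interp B).zone_mul_mem hy (hz.2 B hB)
      · obtain rfl : B = A := by simpa using hB
        exact (isFact_interp B).zone_mul_mem hz.1 hyA
    have := hP _ rfl (z * y) hzy (g * d) (by simpa using Set.mul_mem_mul hg hd)
    simpa only [mul_assoc, mul_left_of_ante_eq_nil hy] using this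
  | bangR Ξ B =>
    intro x hx
    have := hP _ rfl z hz x hx
    obtain rfl : x = 1 := by simpa using hx
    exact subset_cl _ ⟨by simp [hz.1], this⟩
  | absorb Ξ Γ Δ b c B C D hB hC =>
    have h1 := validAt_context.1 (hP _ rfl z
      ⟨hz.1, fun A hA => hz.2 A (Finset.mem_union_right _ hA)⟩)
    rw [validAt_context]
    intro g hg d hd f hf
    have hBC := hz.2 (ldiv B C) (Finset.mem_union_left _ (Finset.mem_singleton_self _)) f
      (hB.interp_eq ▸ subset_cl _ hf)
    rw [hC.interp_eq] at hBC
    have := (isFact_interp D).mul_mul_mem (fun x hx => h1 g hg d hd x hx) hBC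
    rw [← comm_of_ante_eq_nil hz.1] at this
    simp only [mul_assoc, mul_left_of_ante_eq_nil hz.1] at this ⊢
    simpa only [← mul_assoc, mul_self_of_ante_eq_nil hz.1] using this

theorem DyadicCutRule.sound {P : Set DSequent} {s : DSequent} (h : DyadicCutRule P s)
    (hP : ∀ p ∈ P, p.Valid) : s.Valid := by
  intro z hz
  cases h with
  | cut₁ Ξ Γ Θ Δ A C =>
    refine (CutRule.cut Γ Θ Δ A C).sound hz.1 ?_
    rintro p (rfl | rfl)
    · exact hP _ (.inl rfl) z hz
    · exact hP _ (.inr rfl) z hz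
  | cut₂ Ξ Γ B C =>
    -- The first premise, taken at the empty word, puts `z` itself in `interp B`, so the same `z`
    -- realizes the larger zone.
    refine hP _ (.inr rfl) z ⟨hz.1, fun A hA => ?_⟩
    rcases Finset.mem_union.1 hA with hA | hA
    · exact hz.2 A hA
    · obtain rfl : A = B := by simpa using hA
      simpa using hP _ (.inl rfl) z hz 1 rfl

theorem Derivable.valid {L : Set DSequent} {s : DSequent} (h : Derivable L DyadicRule s) :
    s.Valid := by
  induction h with
  | step P s _ hr _ ih => exact hr.elim (·.sound ih) (·.sound ih)

end Interpretation

/-! ### Adequacy of the interpretation and cut-free completeness -/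

section Completeness

open Phase

theorem mem_interpSeq_self {Γ : List Formula} (h : ∀ A ∈ Γ, (⟨∅, [A]⟩ : Phase) ∈ interp A) :
    (⟨∅, Γ⟩ : Phase) ∈ interpSeq Γ := by
  induction Γ with
  | nil => exact rfl
  | cons A Γ ih =>
    rw [interpSeq_cons]
    exact ⟨_, h A List.mem_cons_self, _, ih fun B hB => h B (List.mem_cons_of_mem _ hB), rfl⟩

/-- Here it matters that a variable denotes the least fact containing it: a product of variables is
then generated by a single word. -/
theorem interpSeq_map_var_subset (b : List ℕ) :
    interpSeq (b.map var) ⊆ cl {⟨∅, b.map var⟩} := by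
  induction b with
  | nil => exact subset_cl _
  | cons p b ih =>
    rw [List.map_cons, interpSeq_cons]
    refine (Set.mul_subset_mul le_rfl ih).trans ((isFact_cl _).mul_mem ?_)
    rintro _ ⟨_, rfl, _, rfl, rfl⟩
    exact subset_cl _ rfl

/-- Focused absorption puts an inequation into its own interpretation. -/
theorem IsInequation.zone_mem_interp {A : Formula} (h : IsInequation A) :
    (⟨{bang A}, []⟩ : Phase) ∈ interp A := by
  obtain ⟨b, c, B, C, hB, hC, rfl⟩ := h
  intro x hx
  rw [hB.interp_eq] at hx
  have hfact := isFact_interp C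
  have hx' := (isFact_cl _).cl_subset (interpSeq_map_var_subset b) hx
  suffices h : ∀ x ∈ ({⟨∅, b.map var⟩} : Set Phase), 1 * x * ⟨{bang (ldiv B C)}, []⟩ ∈ interp C by
    simpa using hfact.mul_mul_mem h hx'
  rintro _ rfl
  rw [hC.interp_eq, one_mul]
  intro a d D hD
  -- In a context that proves all of `interpSeq (c.map var)`, the word `c` is provable; absorption
  -- replaces it by the word `b`.
  have hc := hD ⟨∅, c.map var⟩ (mem_interpSeq_self (by
    intro F hF
    obtain ⟨p, _, rfl⟩ := List.mem_map.1 hF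
    exact subset_cl _ rfl))
  have key : Proves ⟨{bang (ldiv B C)} ∪ (a.zone ∪ d.zone), a.ante ++ b.map var ++ d.ante⟩ D := by
    refine Proves.of_rule (.absorb (a.zone ∪ d.zone) a.ante d.ante b c B C D hB hC) ?_
    rintro _ rfl
    simpa [Proves] using hc
  refine key.mono ?_ (by simp)
  intro F
  simp

/-- The two halves need each other at the implications, hence the joint induction. Apart from
variables, the first half applies the left rule of the main connective in an arbitrary context, and
the second applies right rules to generators, the elements proving `A` being a fact. -/
theorem interp_adequate {A : Formula} (hA : A.IsMonoidal) :
    (⟨∅, [A]⟩ : Phase) ∈ interp A ∧ interp A ⊆ {x | Proves x A} := by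
  induction A with
  | var p =>
    refine ⟨subset_cl _ rfl, (isFact_proves _).cl_subset ?_⟩
    rintro _ rfl
    exact Proves.of_actRule (.id _) rfl (by simp)
  | zero =>
    refine ⟨fun a b C _ => ?_, (isFact_proves _).cl_subset (Set.empty_subset _)⟩
    exact Proves.of_actRule (.zeroL a.ante b.ante C) rfl (by simp)
  | one =>
    refine ⟨fun a b C h => ?_, (isFact_proves _).cl_subset ?_⟩
    · refine Proves.of_actRule (.oneL a.ante b.ante C) rfl ?_
      rintro _ rfl
      simpa [Proves] using h 1 rfl
    · rintro _ rfl
      exact Proves.of_actRule .oneR rfl (by simp)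
  | ldiv A B ihA ihB =>
    obtain ⟨hA1, hA2⟩ := ihA hA.1
    obtain ⟨hB1, hB2⟩ := ihB hA.2
    refine ⟨fun x hx => isFact_interp B fun a b C h => ?_, fun y hy => ?_⟩
    · refine Proves.of_actRule (.ldivL a.ante x.ante b.ante A B C) (by simp) ?_
      rintro _ (rfl | rfl)
      · exact (hA2 hx).mono (by intro F; simp; tauto) rfl
      · exact (h _ hB1).mono (by intro F; simp; tauto) (by simp)
    · refine Proves.of_actRule (.ldivR y.ante A B) rfl ?_
      rintro _ rfl
      simpa [Proves] using hB2 (hy _ hA1)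
  | rdiv B A ihB ihA =>
    obtain ⟨hA1, hA2⟩ := ihA hA.2
    obtain ⟨hB1, hB2⟩ := ihB hA.1
    refine ⟨fun x hx => isFact_interp B fun a b C h => ?_, fun y hy => ?_⟩
    · refine Proves.of_actRule (.rdivL a.ante x.ante b.ante A B C) (by simp) ?_
      rintro _ (rfl | rfl)
      · exact (hA2 hx).mono (by intro F; simp; tauto) rfl
      · exact (h _ hB1).mono (by intro F; simp; tauto) (by simp)
    · refine Proves.of_actRule (.rdivR y.ante A B) rfl ?_
      rintro _ rfl
      simpa [Proves] using hB2 (hy _ hA1)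
  | mul A B ihA ihB =>
    obtain ⟨hA1, hA2⟩ := ihA hA.1
    obtain ⟨hB1, hB2⟩ := ihB hA.2
    refine ⟨fun a b C h => ?_, (isFact_proves _).cl_subset ?_⟩
    · refine Proves.of_actRule (.mulL a.ante b.ante A B C) rfl ?_
      rintro _ rfl
      simpa [Proves] using h _ (Set.mul_mem_mul hA1 hB1)
    · rintro _ ⟨x, hx, y, hy, rfl⟩
      refine Proves.of_actRule (.mulR x.ante y.ante A B) rfl ?_
      rintro _ (rfl | rfl)
      · exact (hA2 hx).mono (by simp) rfl
      · exact (hB2 hy).mono (by simp) rfl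
  | plus A B ihA ihB =>
    obtain ⟨hA1, hA2⟩ := ihA hA.1
    obtain ⟨hB1, hB2⟩ := ihB hA.2
    refine ⟨fun a b C h => ?_, (isFact_proves _).cl_subset ?_⟩
    · refine Proves.of_actRule (.plusL a.ante b.ante A B C) rfl ?_
      rintro _ (rfl | rfl)
      · simpa [Proves] using h _ (.inl hA1)
      · simpa [Proves] using h _ (.inr hB1)
    · rintro x (hx | hx)
      · refine Proves.of_actRule (.plusR₁ x.ante A B) rfl ?_
        rintro _ rfl
        exact hA2 hx
      · refine Proves.of_actRule (.plusR₂ x.ante A B) rfl ?_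
        rintro _ rfl
        exact hB2 hx
  | wth A B ihA ihB =>
    obtain ⟨hA1, hA2⟩ := ihA hA.1
    obtain ⟨hB1, hB2⟩ := ihB hA.2
    refine ⟨⟨isFact_interp A fun a b C h => ?_, isFact_interp B fun a b C h => ?_⟩, ?_⟩
    · refine Proves.of_actRule (.wthL₁ a.ante b.ante A B C) rfl ?_
      rintro _ rfl
      simpa [Proves] using h _ hA1
    · refine Proves.of_actRule (.wthL₂ a.ante b.ante A B C) rfl ?_
      rintro _ rfl
      simpa [Proves] using h _ hB1
    · rintro x ⟨hx, hx'⟩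
      refine Proves.of_actRule (.wthR x.ante A B) rfl ?_
      rintro _ (rfl | rfl)
      · exact hA2 hx
      · exact hB2 hx'
  | kstar A ih =>
    obtain ⟨hA1, hA2⟩ := ih hA
    refine ⟨fun a b C h => ?_, (isFact_proves _).cl_subset ?_⟩
    · refine Proves.of_actRule (.starL a.ante b.ante A C) rfl ?_
      rintro _ ⟨n, rfl⟩
      have hn : (⟨∅, List.replicate n A⟩ : Phase) ∈ interp A ^ n := by
        rw [← interpSeq_replicate]
        exact mem_interpSeq_self fun F hF => by rwa [List.eq_of_mem_replicate hF]
      simpa [Proves] using h _ (Set.mem_iUnion.2 ⟨n, hn⟩)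
    · intro x hx
      obtain ⟨n, hn⟩ := Set.mem_iUnion.1 hx
      -- The word of a product of `n` elements of `interp A` splits into `n` pieces, whose zones are
      -- all enlarged to the zone of the product.
      have : ∃ Θs : List (List Formula), x.ante = Θs.flatten ∧
          ∀ Θ ∈ Θs, Proves ⟨x.zone, Θ⟩ A := by
        clear hx
        induction n generalizing x with
        | zero =>
          obtain rfl : x = 1 := by simpa using hn
          exact ⟨[], rfl, by simp⟩
        | succ n ih =>
          rw [pow_succ'] at hn
          obtain ⟨y, hy, w, hw, rfl⟩ := hn
          obtain ⟨Θs, h1, h2⟩ := ih hw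
          refine ⟨y.ante :: Θs, by simp [h1], ?_⟩
          rintro Θ hΘ
          rcases List.mem_cons.1 hΘ with rfl | hΘ
          · exact (hA2 hy).mono (by simp) rfl
          · exact (h2 Θ hΘ).mono (by simp) rfl
      obtain ⟨Θs, h1, h2⟩ := this
      refine Proves.of_actRule (.starR Θs A) h1 ?_
      rintro _ ⟨Θ, hΘ, rfl⟩
      exact h2 Θ hΘ
  | bang A ih =>
    obtain ⟨_, hA2⟩ := ih (IsInequation.isMonoidal hA)
    refine ⟨fun a b C h => ?_, (isFact_proves _).cl_subset ?_⟩
    · refine Proves.of_rule (x := a * ⟨∅, [bang A]⟩ * b)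
        (.bangL (a.zone ∪ ∅ ∪ b.zone) a.ante b.ante A C) ?_
      rintro _ rfl
      -- Only here is it essential that `A` is an inequation: `{!A}` is then a generator of `interp
      -- (bang A)`.
      refine (h ⟨{bang A}, []⟩ ⟨rfl, IsInequation.zone_mem_interp hA⟩).mono ?_ (by simp)
      intro F
      simp
    · rintro ⟨Ξ, Γ⟩ ⟨rfl, hz⟩
      refine Proves.of_rule (.bangR Ξ A) ?_
      rintro _ rfl
      exact hA2 hz

theorem DSequent.Valid.dyadicCutFreeDerivable {s : DSequent} (h : s.Valid) (hs : s ∈ monoidalD) :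
    DyadicCutFreeDerivable s := by
  obtain ⟨h1, h2, h3⟩ := hs
  refine Derivable.restrict DyadicCutFreeRule.premise_monoidalD ?_ ⟨h1, h2, h3⟩
  -- The zone realizes itself: each `{!A}` lies in `interp A`, and the rest of the zone is weakened
  -- in.
  have hz : Realizes ⟨s.zone, []⟩ s.zone := by
    refine ⟨rfl, fun A hA => ?_⟩
    obtain ⟨B, hB, hAB⟩ := h1 _ hA
    obtain rfl : A = B := by simpa using hAB
    refine isFact_interp A fun a b C hC => (hC _ hB.zone_mem_interp).mono ?_ (by simp)
    have := Finset.singleton_subset_iff.2 hA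
    simp only [zone_mul]
    gcongr
  have := (interp_adequate h3).2
    (h _ hz ⟨∅, s.ante⟩ (mem_interpSeq_self fun A hA => (interp_adequate (h2 A hA)).1))
  simpa [Proves] using this

end Completeness

/-! ### Translation of cut-free dyadic derivations -/

section Translation

/-- Cut-free derivability in action logic with exponentiation, without restriction of the
language. -/
def EactProves (Γ : List Formula) (C : Formula) : Prop :=
  Derivable Set.univ EactCutFreeRule ⟨Γ, C⟩

namespace EactProves

theorem of_act {P : Set Sequent} {Γ : List Formula} {C : Formula} (h : ActRule P ⟨Γ, C⟩)
    (hP : ∀ p ∈ P, EactProves p.ante p.succ) : EactProves Γ C :=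
  .step P _ trivial (.inl h) hP

theorem of_bang {Γ' Γ : List Formula} {C' C : Formula} (h : BangRule {⟨Γ', C'⟩} ⟨Γ, C⟩)
    (hP : EactProves Γ' C') : EactProves Γ C :=
  .step _ _ trivial (.inr h) (by rintro _ rfl; exact hP)

variable {L Γ Θ Δ : List Formula} {A C : Formula}

theorem weaken_list (h : EactProves (Γ ++ Δ) C) : EactProves (Γ ++ L.map bang ++ Δ) C := by
  induction L generalizing Γ with
  | nil => simpa using h
  | cons A L ih =>
    have := of_bang (.weak Γ (L.map bang ++ Δ) A C) (by simpa using ih h)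
    simpa using this

theorem move_right_list (h : EactProves (Γ ++ L.map bang ++ Θ ++ Δ) C) :
    EactProves (Γ ++ Θ ++ L.map bang ++ Δ) C := by
  induction L generalizing Θ with
  | nil => simpa using h
  | cons A L ih =>
    have h1 := of_bang (.perm₂ Γ (L.map bang ++ Θ) Δ A C) (by
      have := of_bang (.perm₁ Γ [] (L.map bang ++ Θ ++ Δ) A C) (by simpa using h)
      simpa using this)
    have h2 := ih (Θ := Θ ++ [bang A]) (by simpa using h1)
    simpa using of_bang (.perm₁ (Γ ++ Θ) [] (L.map bang ++ Δ) A C) (by simpa using h2)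

/-- A formula of the zone can be contracted into the zone. -/
theorem contract_mem (hA : A ∈ L)
    (h : EactProves (L.map bang ++ Γ ++ [bang A] ++ Δ) C) :
    EactProves (L.map bang ++ Γ ++ Δ) C := by
  obtain ⟨L₁, L₂, rfl⟩ := List.append_of_mem hA
  have h1 := of_bang (.perm₁ (L₁.map bang ++ [bang A]) (L₂.map bang ++ Γ) Δ A C)
    (by simpa using h)
  simpa using of_bang (.contr (L₁.map bang) (L₂.map bang ++ Γ ++ Δ) A C) (by simpa using h1)

theorem contract_list {L' : List Formula} (hL : L' ⊆ L)
    (h : EactProves (L.map bang ++ Γ ++ L'.map bang ++ Δ) C) :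
    EactProves (L.map bang ++ Γ ++ Δ) C := by
  induction L' with
  | nil => simpa using h
  | cons A L' ih =>
    refine ih (fun F hF => hL (List.mem_cons_of_mem _ hF)) ?_
    have := contract_mem (Γ := Γ) (Δ := L'.map bang ++ Δ) (hL List.mem_cons_self)
      (by simpa using h)
    simpa using this

theorem flatten_zone {Θs : List (List Formula)}
    (h : EactProves (L.map bang ++ Γ ++ (Θs.map (L.map bang ++ ·)).flatten) C) :
    EactProves (L.map bang ++ Γ ++ Θs.flatten) C := by
  induction Θs generalizing Γ with
  | nil => simpa using h
  | cons Θ Θs ih =>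
    have h1 := contract_list (List.Subset.refl L) (Γ := Γ)
      (Δ := Θ ++ (Θs.map (L.map bang ++ ·)).flatten) (by simpa using h)
    have h2 := ih (Γ := Γ ++ Θ) (by simpa using h1)
    simpa using h2

theorem of_isProd_left {b : List ℕ} {B : Formula} (hB : IsProd b B)
    (h : EactProves (Γ ++ b.map var ++ Δ) C) : EactProves (Γ ++ [B] ++ Δ) C := by
  induction hB generalizing Γ Δ with
  | nil => exact of_act (.oneL Γ Δ C) (by rintro _ rfl; simpa using h)
  | single p => exact h
  | mul b c B D _ _ _ _ hB hD =>
    refine of_act (.mulL Γ Δ B D C) ?_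
    rintro _ rfl
    have h1 := hB (Γ := Γ) (Δ := c.map var ++ Δ) (by simpa using h)
    have h2 := hD (Γ := Γ ++ [B]) (Δ := Δ) (by simpa using h1)
    simpa using h2

theorem of_isProd_right {b : List ℕ} {B : Formula} (hB : IsProd b B) :
    EactProves (b.map var) B := by
  induction hB with
  | nil => exact of_act .oneR (by simp)
  | single p => exact of_act (.id _) (by simp)
  | mul b c B D _ _ _ _ hB hD =>
    rw [List.map_append]
    refine of_act (.mulR _ _ B D) ?_
    rintro _ (rfl | rfl)
    · exact hB
    · exact hD

/-- Axioms with a fixed antecedent acquire the prefix by weakening. A rule that joins antecedents of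
several premises produces several copies of the prefix, and these are contracted into one. -/
theorem of_actRule_zone {P : Set Sequent} {s : Sequent} (h : ActRule P s)
    (hP : ∀ p ∈ P, EactProves (L.map bang ++ p.ante) p.succ) :
    EactProves (L.map bang ++ s.ante) s.succ := by
  cases h with
  | id A =>
    simpa using weaken_list (Γ := []) (L := L) (of_act (.id A) (by simp))
  | ldivL Γ Θ Δ A B C =>
    have h1 := hP _ (.inl rfl)
    have h2 := hP _ (.inr rfl)
    have := of_act (.ldivL (L.map bang ++ Γ) (L.map bang ++ Θ) Δ A B C) (by
      rintro _ (rfl | rfl)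
      · exact h1
      · simpa using h2)
    simpa using contract_list (List.Subset.refl L) (Γ := Γ) (Δ := Θ ++ [ldiv A B] ++ Δ)
      (by simpa using this)
  | ldivR Θ A B =>
    refine of_act (.ldivR _ A B) ?_
    rintro _ rfl
    -- The rule needs `A` leftmost, so the prefix is moved past it.
    simpa using move_right_list (Γ := []) (Θ := [A]) (L := L) (by simpa using hP _ rfl)
  | rdivL Γ Θ Δ A B C =>
    have h1 := hP _ (.inl rfl)
    have h2 := hP _ (.inr rfl)
    have := of_act (.rdivL (L.map bang ++ Γ) (L.map bang ++ Θ) Δ A B C) (by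
      rintro _ (rfl | rfl)
      · exact h1
      · simpa using h2)
    simpa using contract_list (List.Subset.refl L) (Γ := Γ ++ [rdiv B A]) (Δ := Θ ++ Δ)
      (by simpa using this)
  | rdivR Θ A B =>
    refine of_act (.rdivR _ A B) ?_
    rintro _ rfl
    simpa using hP _ rfl
  | mulL Γ Δ A B C =>
    simpa using of_act (.mulL (L.map bang ++ Γ) Δ A B C)
      (by rintro _ rfl; simpa using hP _ rfl)
  | mulR Γ Δ A B =>
    have h1 := hP _ (.inl rfl)
    have h2 := hP _ (.inr rfl)
    have := of_act (.mulR (L.map bang ++ Γ) (L.map bang ++ Δ) A B) (by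
      rintro _ (rfl | rfl)
      · exact h1
      · exact h2)
    simpa using contract_list (List.Subset.refl L) (Γ := Γ) (Δ := Δ) (by simpa using this)
  | oneL Γ Δ C =>
    simpa using of_act (.oneL (L.map bang ++ Γ) Δ C) (by rintro _ rfl; simpa using hP _ rfl)
  | oneR =>
    simpa using weaken_list (Γ := []) (L := L) (of_act .oneR (by simp))
  | zeroL Γ Δ C =>
    simpa using of_act (.zeroL (L.map bang ++ Γ) Δ C) (by simp)
  | plusL Γ Δ A₁ A₂ C =>
    have h1 := hP _ (.inl rfl)
    have h2 := hP _ (.inr rfl)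
    simpa using of_act (.plusL (L.map bang ++ Γ) Δ A₁ A₂ C) (by
      rintro _ (rfl | rfl)
      · simpa using h1
      · simpa using h2)
  | plusR₁ Θ A₁ A₂ => exact of_act (.plusR₁ _ A₁ A₂) (by rintro _ rfl; exact hP _ rfl)
  | plusR₂ Θ A₁ A₂ => exact of_act (.plusR₂ _ A₁ A₂) (by rintro _ rfl; exact hP _ rfl)
  | wthL₁ Γ Δ A₁ A₂ C =>
    simpa using of_act (.wthL₁ (L.map bang ++ Γ) Δ A₁ A₂ C)
      (by rintro _ rfl; simpa using hP _ rfl)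
  | wthL₂ Γ Δ A₁ A₂ C =>
    simpa using of_act (.wthL₂ (L.map bang ++ Γ) Δ A₁ A₂ C)
      (by rintro _ rfl; simpa using hP _ rfl)
  | wthR Θ A₁ A₂ =>
    refine of_act (.wthR _ A₁ A₂) ?_
    rintro _ (rfl | rfl)
    · exact hP _ (.inl rfl)
    · exact hP _ (.inr rfl)
  | starL Γ Δ A C =>
    have := of_act (.starL (L.map bang ++ Γ) Δ A C) (by
      rintro _ ⟨n, rfl⟩
      simpa using hP _ ⟨n, rfl⟩)
    simpa using this
  | starR Θs A =>
    have := of_act (.starR (Θs.map (L.map bang ++ ·)) A) (by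
      rintro _ ⟨Θ', hΘ', rfl⟩
      obtain ⟨Θ, hΘ, rfl⟩ := List.mem_map.1 hΘ'
      exact hP _ ⟨Θ, hΘ, rfl⟩)
    -- An extra copy of the prefix is weakened in, since there is none when `Θs` is empty; all
    -- others are contracted into it.
    have h1 := weaken_list (Γ := []) (L := L) this
    simpa using flatten_zone (L := L) (Γ := []) (by simpa using h1)

end EactProves

open EactProves in
/-- The formulae of the `!`-zone can be listed in front of the antecedent. -/
theorem Derivable.eactProves {s : DSequent} (h : Derivable Set.univ DyadicCutFreeRule s)
    (L : List Formula) (hL : ∀ A, A ∈ s.zone → A ∈ L.map bang) :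
    EactProves (L.map bang ++ s.ante) s.succ := by
  -- Requiring only that `L` cover the zone, with repetitions and extra formulae allowed, reconciles
  -- set-valued zones with lists.
  induction h generalizing L with
  | step P s _ hr _ ih =>
    cases hr with
    | act Ξ P s h => exact of_actRule_zone h fun p hp => ih _ ⟨p, hp, rfl⟩ L hL
    | bangL Ξ Γ Δ A C =>
      have h1 := ih _ rfl (L ++ [A]) fun F hF => by
        rcases Finset.mem_union.1 hF with hF | hF
        · rw [List.map_append]
          exact List.mem_append_left _ (hL F hF)
        · simp [Finset.mem_singleton.1 hF]
      simpa using of_bang (.perm₂ (L.map bang) Γ Δ A C) (by simpa using h1)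
    | bangR Ξ B =>
      have h1 := ih _ rfl L hL
      simpa using of_bang (.bangR L B) (by simpa using h1)
    | absorb Ξ Γ Δ b c B C D hB hC =>
      have h1 := ih _ rfl L fun F hF => hL F (Finset.mem_union_right _ hF)
      have hmem : ldiv B C ∈ L := by
        simpa using hL _ (Finset.mem_union_left _ (Finset.mem_singleton_self _))
      -- Absorption is simulated without cut: `C` is assembled from the word `c`, `B \ C` is
      -- introduced against the derivation of `B` from the word `b`, and the resulting `!(B \ C)` is
      -- contracted into the prefix.
      have h2 := of_isProd_left hC (Γ := L.map bang ++ Γ) (Δ := Δ) (by simpa using h1)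
      have h3 := of_act (.ldivL (L.map bang ++ Γ) (b.map var) Δ B C D) (by
        rintro _ (rfl | rfl)
        · exact of_isProd_right hB
        · exact h2)
      have h4 := of_bang (.bangL (L.map bang ++ Γ ++ b.map var) Δ (ldiv B C) D) h3
      simpa using contract_mem (Γ := Γ ++ b.map var) (Δ := Δ) hmem (by simpa using h4)

end Translation

/-! ### Cut elimination and equivalence of the calculi -/

theorem DyadicDerivable.cutFree {s : DSequent} (h : DyadicDerivable s) :
    DyadicCutFreeDerivable s :=
  h.valid.dyadicCutFreeDerivable h.mem

theorem EactmDerivable.dyadicDerivable {Θ : List Formula} {C : Formula}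
    (h : EactmDerivable ⟨Θ, C⟩) : DyadicDerivable ⟨∅, Θ, C⟩ := by
  -- Validity at `1` passes to every zone-only `z` by weakening.
  have hv : DSequent.Valid ⟨∅, Θ, C⟩ := fun z hz x hx =>
    (isFact_interp C).zone_mul_mem hz.1 (by simpa using h.validAt_one x hx)
  exact (hv.dyadicCutFreeDerivable ⟨by simp, h.mem⟩).mono le_rfl fun _ _ => .inl

theorem DyadicDerivable.eactmCutFreeDerivable {Θ : List Formula} {C : Formula}
    (h : DyadicDerivable ⟨∅, Θ, C⟩) : EactmCutFreeDerivable ⟨Θ, C⟩ :=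
  ((h.cutFree.mono (Set.subset_univ _) fun _ _ => id).eactProves [] (by simp)).restrict
    EactCutFreeRule.premise_monoidal h.mem.2

theorem EactmCutFreeDerivable.eactmDerivable {s : Sequent} (h : EactmCutFreeDerivable s) :
    EactmDerivable s :=
  h.mono le_rfl fun _ _ => .inl

end DyadicACT

open DyadicACT in
/-- Cut elimination for the dyadic calculus, and its equivalence with the monoidal fragment of
infinitary action logic with exponentiation (whether or not Cut is counted among the rules of the
latter). -/
theorem proposition3p4 :
    (∀ s : DSequent, DyadicDerivable s → DyadicCutFreeDerivable s) ∧
    (∀ (Θ : List Formula) (C : Formula),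
      (EactmDerivable ⟨Θ, C⟩ ↔ DyadicDerivable ⟨∅, Θ, C⟩) ∧
      (EactmCutFreeDerivable ⟨Θ, C⟩ ↔ DyadicDerivable ⟨∅, Θ, C⟩)) :=
  ⟨fun _ => DyadicDerivable.cutFree, fun _ _ =>
    ⟨⟨EactmDerivable.dyadicDerivable, fun h => h.eactmCutFreeDerivable.eactmDerivable⟩,
      ⟨fun h => h.eactmDerivable.dyadicDerivable, DyadicDerivable.eactmCutFreeDerivable⟩⟩⟩
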